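/- Let $\phi:\mathbb R\to\mathbb R$ be a sigmoidal function with $\phi(z)\to\pm1$ as $z\to\pm\infty$ that is bounded, Lipschitz and differentiable with bounded derivative, and let $m\ge 1$ be an integer. There is a constant $\delta_0>0$, depending only on $\phi$ and $m$, such that the following holds. Let $p,d\ge 0$ be integers, $\beta_d\in\mathbb R^{p\times d}$ with columns $\beta^{(1)},\dots,\beta^{(d)}$, and let $\mu$ be a probability measure on $\mathbb R^p$ with $\beta_d^Tx\in[-1,1]^d$ for $\mu$-almost every $x$. Let $f(x)=g(\beta_d^Tx)$, where $g:\mathbb R^d\to\mathbb R$ is integrable with integrable Fourier transform $\tilde g(\eta)=\int_{\mathbb R^d}e^{-2\pi i\eta^Tz}g(z)\,dz$, satisfies $g(z)=\int_{\mathbb R^d}e^{2\pi i\eta^Tz}\tilde g(\eta)\,d\eta$ for all $z$, and has finite first absolute moment of the Fourier magnitude distribution $$C_g=\int_{\mathbb R^d}\|2\pi\eta\|_1\,|\tilde g(\eta)|\,d\eta<\infty .$$ Let $C\ge C_g$, $C>0$, and let $\delta\ge\delta_0$ satisfy $\|\beta^{(j)}\|_1\le\delta$ for $j=1,\dots,d$.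 Then there are $\bar u_1,\dots,\bar u_m\in\mathbb R^d$ and $\bar v_1,\dots,\bar v_m,\bar\tau_1,\dots,\bar\tau_m,\bar\tau_0\in\mathbb R$ such that the network with two hidden layers $$f_{d,m}(x,\bar\theta,\beta_d)=\sum_{i=1}^m\bar\tau_i\,\phi\big(\bar u_i^T I(\beta_d^Tx)+\bar v_i\big)+\bar\tau_0,$$ where $I$ is the identity, satisfies $$\Big(\int|f(x)-f_{d,m}(x,\bar\theta,\beta_d)|^2\,\mu(dx)\Big)^{1/2}\le\frac{2C_g}{\sqrt m}$$ and $(\bar\theta,\beta_d)\in\Theta_{d,m,\delta,C}$, that is, $\sum_{i=1}^m|\bar\tau_i|<C$, $|\bar\tau_0-g(0)|<C$, $|\bar v_i|\le\|\bar u_i\|_1\le\delta$ for all $i$, and $\|\beta^{(j)}\|_1\le\delta$ for all $j$. -/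

import Mathlib

open MeasureTheory Filter Topology
open scoped FourierTransform Matrix ENNReal

noncomputable section

/-- The Fourier transform `g̃(η) = ∫ exp(-2πi ηᵀz) g(z) dz` of a real function `g` on `ℝᵈ`. -/
def fourierOf {d : ℕ} (g : (Fin d → ℝ) → ℝ) : EuclideanSpace ℝ (Fin d) → ℂ :=
  𝓕 (fun z : EuclideanSpace ℝ (Fin d) => (g z.ofLp : ℂ))

/-- The first absolute moment `C_g = ∫ ‖2πη‖₁ |g̃(η)| dη` of the Fourier magnitude distribution
of `g`; `2πη` is the (angular) frequency vector of the wave `z ↦ exp(2πi ηᵀz)`. -/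
def fourierMoment {d : ℕ} (g : (Fin d → ℝ) → ℝ) : ℝ :=
  ∫ η : EuclideanSpace ℝ (Fin d), (∑ j, |2 * Real.pi * η j|) * ‖fourierOf g η‖

/-- `g` has the Fourier representation `g(z) = ∫ exp(2πi ηᵀz) g̃(η) dη` at every point, and its
first absolute Fourier moment is finite. -/
structure HasFiniteFourierMoment {d : ℕ} (g : (Fin d → ℝ) → ℝ) : Prop where
  integrable : Integrable (fun z : EuclideanSpace ℝ (Fin d) => g z.ofLp)
  integrable_fourier : Integrable (fourierOf g)
  representation : ∀ z : EuclideanSpace ℝ (Fin d), (g z.ofLp : ℂ) = 𝓕⁻ (fourierOf g) z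
  integrable_moment : Integrable
    (fun η : EuclideanSpace ℝ (Fin d) => (∑ j, |2 * Real.pi * η j|) * ‖fourierOf g η‖)

/-- A sigmoidal activation function, with limits `±1` at `±∞` (as for `tanh`), that is bounded,
Lipschitz and has a bounded derivative. -/
structure IsSigmoidalActivation (φ : ℝ → ℝ) : Prop where
  tendsto_atTop : Tendsto φ atTop (𝓝 1)
  tendsto_atBot : Tendsto φ atBot (𝓝 (-1))
  differentiable : Differentiable ℝ φ
  deriv_bounded : ∃ M : ℝ, ∀ z, |deriv φ z| ≤ M
  lipschitz : ∃ a₁ : ℝ, 0 < a₁ ∧ ∀ z z', |φ z - φ z'| ≤ a₁ * |z - z'|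
  bounded : ∃ a₀ : ℝ, 1 ≤ a₀ ∧ ∀ z, |φ z| ≤ a₀

/-- The parameters `θ = (u_i, v_i, τ_i, τ₀)` of the second hidden layer (`m` nodes, `k` inputs)
and of the output layer. -/
structure NetParams (k m : ℕ) where
  u : Fin m → Fin k → ℝ
  v : Fin m → ℝ
  τ : Fin m → ℝ
  τ₀ : ℝ

/-- The first hidden layer: `k` nodes without bias, whose weights are the columns of `w`, with
the identity as activation function. -/
def firstLayer {p k : ℕ} (w : Matrix (Fin p) (Fin k) ℝ) (x : Fin p → ℝ) : Fin k → ℝ :=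
  fun j => id ((wᵀ *ᵥ x) j)

/-- The network with two hidden layers
`f_{k,m}(x, θ, w) = ∑ i, τ_i φ(u_iᵀ I(wᵀ x) + v_i) + τ₀`. -/
def twoLayerNet (φ : ℝ → ℝ) {p k m : ℕ} (θ : NetParams k m) (w : Matrix (Fin p) (Fin k) ℝ)
    (x : Fin p → ℝ) : ℝ :=
  ∑ i, θ.τ i * φ (θ.u i ⬝ᵥ firstLayer w x + θ.v i) + θ.τ₀

/-- The parameter set `Θ_{d,m,δ,C}`; the number `g0` is the value at `0` of the target `g`. -/
def paramSet (p d m : ℕ) (δ C g0 : ℝ) : Set (NetParams d m × Matrix (Fin p) (Fin d) ℝ) :=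
  {q | ∑ i, |q.1.τ i| < C ∧ |q.1.τ₀ - g0| < C ∧
    (∀ i, |q.1.v i| ≤ ∑ j, |q.1.u i j|) ∧ (∀ i, ∑ j, |q.1.u i j| ≤ δ) ∧
    (∀ j, ∑ l, |q.2 l j| ≤ δ)}

end

/-! Write `G` for the Fourier transform of `g`, `w = ‖2πη‖₁` and `t = 2πηᵀz / w`, so `|t| ≤ 1` on
the cube. The fundamental theorem of calculus turns each wave `Re (G (exp (iwt) - 1))` into `w |G|`
times the integral from `0` to `t` of a function `k` bounded by `1`. That integral is the mean of `k
s * (unitStep (t - s) + unitStep s)` for `s` uniform on `[-1, 1]` (`integral_mul_unitStep`). Hence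
`g z - g 0` is `C_g` times an expectation over random `(η, s)`, with `η` drawn with density `w |G| /
C_g` (`sub_eq_integral_waveMeasure`). The second step does not involve `z`, so its mean goes into
`τ₀`; the first is a signed ridge step, which a steep sigmoid `φ (δ (t - s))` imitates.

The mean error of this imitation over `s` is small uniformly in `t`, since the sigmoid differs
appreciably from the step only on a window of length `O(1/δ)`. The threshold for `δ` therefore
depends only on `φ` and `m` (`exists_scale_integral_le`). Averaging `m` independent nodes gives
squared bias at most `C_g² / m` and variance at most `3 C_g² / m`, so some sample achieves error `2
C_g / √m` (`exists_average_eLpNorm_le`). -/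

noncomputable section

/-! ### Monte Carlo sampling with bias -/

open ProbabilityTheory in
/-- The mean squared error of the average of `m` independent copies of `Y` as an estimate
of `c`: squared bias plus variance. -/
theorem integral_sq_sub_average_le {Ω : Type*} [MeasurableSpace Ω] (P : Measure Ω)
    [IsProbabilityMeasure P] {m : ℕ} (hm : 1 ≤ m) {Y : Ω → ℝ} (hY : MemLp Y 2 P)
    {c b V : ℝ} (hb : |c - ∫ ω, Y ω ∂P| ≤ b) (hV : ∫ ω, Y ω ^ 2 ∂P ≤ V) :
    ∫ ω, (c - (∑ i, Y (ω i)) / m) ^ 2 ∂(Measure.pi fun _ : Fin m => P) ≤ b ^ 2 + V / m := by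
  have hm0 : (0 : ℝ) < m := by exact_mod_cast hm
  have hYi : ∀ i : Fin m, MemLp (fun ω : Fin m → Ω => Y (ω i)) 2 (Measure.pi fun _ => P) :=
    fun i => hY.comp_measurePreserving (measurePreserving_eval (fun _ : Fin m => P) i)
  have hS : MemLp (fun ω : Fin m → Ω => ∑ i, Y (ω i)) 2 (Measure.pi fun _ => P) :=
    memLp_finsetSum _ fun i _ => hYi i
  have hA : MemLp (fun ω : Fin m → Ω => (∑ i, Y (ω i)) / m) 2 (Measure.pi fun _ => P) := by
    simpa [div_eq_inv_mul] using hS.const_mul ((m : ℝ)⁻¹)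
  have hZ : MemLp (fun ω : Fin m → Ω => c - (∑ i, Y (ω i)) / m) 2 (Measure.pi fun _ => P) :=
    (memLp_const c).sub hA
  have hmean : ∫ ω, (c - (∑ i, Y (ω i)) / m) ∂(Measure.pi fun _ : Fin m => P)
      = c - ∫ ω, Y ω ∂P := by
    rw [integral_sub (integrable_const c) (hA.integrable (by norm_num)), integral_div,
      integral_finsetSum _ fun i _ => (hYi i).integrable (by norm_num)]
    have : ∀ i : Fin m, ∫ ω, Y (ω i) ∂(Measure.pi fun _ : Fin m => P) = ∫ ω, Y ω ∂P := fun i =>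
      integral_comp_eval (μ := fun _ : Fin m => P) (f := Y) hY.aestronglyMeasurable
    simp only [this]
    simp [hm0.ne']
  have hvar : Var[fun ω => c - (∑ i, Y (ω i)) / m; Measure.pi fun _ : Fin m => P] ≤ V / m := by
    rw [variance_const_sub hA.aestronglyMeasurable]
    have h1 : (fun ω : Fin m → Ω => (∑ i, Y (ω i)) / m)
        = fun ω => (m : ℝ)⁻¹ * (∑ i, fun ω : Fin m → Ω => Y (ω i)) ω := by
      ext ω; simp [div_eq_inv_mul]
    rw [h1, variance_const_mul, variance_sum_pi (X := fun _ => Y) fun _ => hY]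
    have h2 : Var[Y; P] ≤ V := (variance_le_expectation_sq hY.aestronglyMeasurable).trans hV
    simp only [Finset.sum_const, Finset.card_univ, Fintype.card_fin, nsmul_eq_mul]
    calc ((m : ℝ)⁻¹) ^ 2 * (m * Var[Y; P]) = Var[Y; P] / m := by field_simp
      _ ≤ V / m := by gcongr
  have h3 := variance_eq_sub hZ
  rw [hmean] at h3
  have h4 : (c - ∫ ω, Y ω ∂P) ^ 2 ≤ b ^ 2 := by
    rw [← sq_abs]; gcongr
  have h5 : ∫ ω, (c - (∑ i, Y (ω i)) / m) ^ 2 ∂(Measure.pi fun _ : Fin m => P)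
    = Var[fun ω => c - (∑ i, Y (ω i)) / m; Measure.pi fun _ : Fin m => P]
      + (c - ∫ ω, Y ω ∂P) ^ 2 := by
    rw [h3]; simp
  linarith

/-- **Maurey's lemma** with bias: some sample average of the random function `Y` approximates `F`
in `L²(μ)`. -/
theorem exists_average_eLpNorm_le {Ω X : Type*} [MeasurableSpace Ω] [MeasurableSpace X]
    (P : Measure Ω) [IsProbabilityMeasure P] (μ : Measure X) [IsProbabilityMeasure μ]
    {m : ℕ} (hm : 1 ≤ m) {Y : Ω → X → ℝ} (hY : Measurable (Function.uncurry Y))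
    {K : ℝ} (hK : ∀ ω x, |Y ω x| ≤ K) {F : X → ℝ} (hF : Measurable F) {b V r : ℝ}
    (hb : ∀ᵐ x ∂μ, |F x - ∫ ω, Y ω x ∂P| ≤ b)
    (hV : ∀ᵐ x ∂μ, ∫ ω, Y ω x ^ 2 ∂P ≤ V) (hr : 0 ≤ r) (hbV : b ^ 2 + V / m ≤ r ^ 2) :
    ∃ ω : Fin m → Ω,
      eLpNorm (fun x => F x - (∑ i, Y (ω i) x) / m) 2 μ ≤ ENNReal.ofReal r := by
  have hYx : ∀ x, Measurable fun ω => Y ω x := fun x => hY.comp measurable_prodMk_right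
  have hmeas : Measurable fun q : (Fin m → Ω) × X => F q.2 - (∑ i, Y (q.1 i) q.2) / m := by
    have : ∀ i : Fin m, Measurable fun q : (Fin m → Ω) × X => Y (q.1 i) q.2 := fun i =>
      hY.comp (g := Function.uncurry Y) (f := fun q : (Fin m → Ω) × X => (q.1 i, q.2))
        (((measurable_pi_apply i).comp measurable_fst).prodMk measurable_snd)
    fun_prop
  have hmemY : ∀ x, MemLp (fun ω => Y ω x) 2 P := fun x =>
    MemLp.of_bound (hYx x).aestronglyMeasurable K (ae_of_all _ fun ω => hK ω x)
  have hx : ∀ᵐ x ∂μ, ∫⁻ ω, ‖F x - (∑ i, Y (ω i) x) / m‖ₑ ^ 2 ∂(Measure.pi fun _ : Fin m => P)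
      ≤ ENNReal.ofReal (r ^ 2) := by
    filter_upwards [hb, hV] with x hbx hVx
    have hmem : MemLp (fun ω : Fin m → Ω => F x - (∑ i, Y (ω i) x) / m) 2
        (Measure.pi fun _ => P) := by
      refine (memLp_const _).sub ?_
      have : MemLp (fun ω : Fin m → Ω => ∑ i, Y (ω i) x) 2 (Measure.pi fun _ => P) :=
        memLp_finsetSum _ fun i _ =>
          (hmemY x).comp_measurePreserving (measurePreserving_eval (fun _ : Fin m => P) i)
      simpa [div_eq_inv_mul] using this.const_mul ((m : ℝ)⁻¹)
    have hle := (integral_sq_sub_average_le P hm (hmemY x) hbx hVx).trans hbV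
    refine le_trans (le_of_eq ?_) (ENNReal.ofReal_le_ofReal hle)
    rw [ofReal_integral_eq_lintegral_ofReal hmem.integrable_sq (ae_of_all _ fun _ => sq_nonneg _)]
    refine lintegral_congr fun ω => ?_
    rw [← sq_abs, ENNReal.ofReal_pow (abs_nonneg _), ← Real.enorm_eq_ofReal_abs]
  -- By Tonelli the bound for almost every `x` controls the mean over samples of the squared `L²(μ)`
  -- error; some sample does not exceed that mean.
  have htot : ∫⁻ ω, ∫⁻ x, ‖F x - (∑ i, Y (ω i) x) / m‖ₑ ^ 2 ∂μ ∂(Measure.pi fun _ : Fin m => P)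
      ≤ ENNReal.ofReal (r ^ 2) := by
    rw [lintegral_lintegral_swap (hmeas.enorm.pow_const 2).aemeasurable]
    refine (lintegral_mono_ae hx).trans ?_
    simp
  obtain ⟨ω, hω⟩ := exists_le_lintegral (μ := Measure.pi fun _ : Fin m => P)
    ((hmeas.enorm.pow_const 2).lintegral_prod_right' (ν := μ)).aemeasurable
  refine ⟨ω, ?_⟩
  have h2 := hω.trans htot
  have h3 := eLpNorm_nnreal_pow_eq_lintegral (μ := μ) (p := 2)
    (f := fun x => F x - (∑ i, Y (ω i) x) / m) (by norm_num)
  have h4 : eLpNorm (fun x => F x - (∑ i, Y (ω i) x) / m) 2 μ ^ 2 ≤ ENNReal.ofReal r ^ 2 := by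
    rw [← ENNReal.ofReal_pow hr]
    refine le_trans (le_of_eq ?_) h2
    simpa using h3
  exact (ENNReal.pow_le_pow_left_iff two_ne_zero).1 h4

/-! ### Steps and steep sigmoids -/

/-- The step function from `-1` to `1`. -/
def unitStep (x : ℝ) : ℝ := if 0 < x then 1 else -1

theorem measurable_unitStep : Measurable unitStep :=
  Measurable.ite measurableSet_Ioi measurable_const measurable_const

theorem abs_unitStep (x : ℝ) : |unitStep x| = 1 := by
  unfold unitStep; split_ifs <;> simp

theorem unitStep_mul {a x : ℝ} (ha : 0 < a) : unitStep (a * x) = unitStep x := by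
  simp [unitStep, ha]

/-- A function on `[-1, 1]` weighted by steps at `0` and at `t` has the integral from `0` to `t`. -/
theorem integral_mul_unitStep {k : ℝ → ℝ} (hk : Continuous k) {t : ℝ} (ht : |t| ≤ 1) :
    ∫ s in (-1)..1, k s * (unitStep (t - s) + unitStep s) = 2 * ∫ s in (0)..t, k s := by
  obtain ⟨h1, h2⟩ := abs_le.1 ht
  have hI : ∀ a b, IntervalIntegrable k volume a b := fun a b => hk.intervalIntegrable a b
  have hM : ∀ a b, IntervalIntegrable (fun s => k s * (unitStep (t - s) + unitStep s))
      volume a b := fun a b => by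
    have hm : Measurable fun s => unitStep (t - s) + unitStep s :=
      (measurable_unitStep.comp (by fun_prop)).add measurable_unitStep
    refine ((hI a b).norm.mul_const 2).mono_fun
      ((hk.measurable.mul hm).aestronglyMeasurable) (ae_of_all _ fun s => ?_)
    have h := abs_add_le (unitStep (t - s)) (unitStep s)
    rw [abs_unitStep, abs_unitStep] at h
    simp only [norm_mul, Real.norm_eq_abs, abs_abs, abs_two]
    exact mul_le_mul_of_nonneg_left (by linarith) (abs_nonneg _)
  rcases le_total 0 t with h0 | h0
  · rw [← intervalIntegral.integral_add_adjacent_intervals (hM (-1) 0) (hM 0 1),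
      ← intervalIntegral.integral_add_adjacent_intervals (hM 0 t) (hM t 1)]
    have e1 : ∫ s in (-1)..0, k s * (unitStep (t - s) + unitStep s) = 0 := by
      refine intervalIntegral.integral_zero_ae ?_
      -- The interval contains its right endpoint, where a strict comparison may fail; that point is
      -- a null set.
      filter_upwards [compl_mem_ae_iff.2 (measure_singleton (μ := volume) (0 : ℝ))] with s hs0 hs
      rw [Set.uIoc_of_le (by norm_num)] at hs
      have hs0' : s < 0 := lt_of_le_of_ne hs.2 hs0
      simp [unitStep, hs0'.not_gt, show s < t by linarith]
    have e2 : ∫ s in (0)..t, k s * (unitStep (t - s) + unitStep s) = ∫ s in (0)..t, k s * 2 := by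
      refine intervalIntegral.integral_congr_ae ?_
      filter_upwards [compl_mem_ae_iff.2 (measure_singleton (μ := volume) t)] with s hs0 hs
      rw [Set.uIoc_of_le h0] at hs
      have hs0' : s < t := lt_of_le_of_ne hs.2 hs0
      simp [unitStep, hs.1, hs0']; norm_num
    have e3 : ∫ s in t..1, k s * (unitStep (t - s) + unitStep s) = 0 := by
      refine intervalIntegral.integral_zero_ae (ae_of_all _ fun s hs => ?_)
      rw [Set.uIoc_of_le h2] at hs
      simp [unitStep, hs.1.not_gt, show 0 < s by linarith [hs.1]]
    rw [e1, e2, e3, intervalIntegral.integral_mul_const]; ring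
  · rw [← intervalIntegral.integral_add_adjacent_intervals (hM (-1) 0) (hM 0 1),
      ← intervalIntegral.integral_add_adjacent_intervals (hM (-1) t) (hM t 0)]
    have e1 : ∫ s in (-1)..t, k s * (unitStep (t - s) + unitStep s) = 0 := by
      refine intervalIntegral.integral_zero_ae ?_
      filter_upwards [compl_mem_ae_iff.2 (measure_singleton (μ := volume) t)] with s hs0 hs
      rw [Set.uIoc_of_le h1] at hs
      have hs0' : s < t := lt_of_le_of_ne hs.2 hs0
      simp [unitStep, hs0', show ¬ 0 < s by linarith]
    have e2 : ∫ s in t..0, k s * (unitStep (t - s) + unitStep s) = ∫ s in t..0, k s * (-2) := by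
      refine intervalIntegral.integral_congr_ae (ae_of_all _ fun s hs => ?_)
      rw [Set.uIoc_of_le h0] at hs
      simp [unitStep, hs.1.not_gt, hs.2.not_gt]; norm_num
    have e3 : ∫ s in (0)..1, k s * (unitStep (t - s) + unitStep s) = 0 := by
      refine intervalIntegral.integral_zero_ae (ae_of_all _ fun s hs => ?_)
      rw [Set.uIoc_of_le (by norm_num)] at hs
      simp [unitStep, hs.1, show ¬ s < t by linarith [hs.1]]
    rw [e1, e2, e3, intervalIntegral.integral_mul_const, intervalIntegral.integral_symm]; ring

/-- Sliding averages of a bounded function vanishing at infinity are uniformly small at large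
scales. -/
theorem exists_scale_integral_le {e : ℝ → ℝ} (he : Measurable e) {K : ℝ} (hK : ∀ r, |e r| ≤ K)
    (htop : Tendsto e atTop (𝓝 0)) (hbot : Tendsto e atBot (𝓝 0)) {ε : ℝ} (hε : 0 < ε) :
    ∃ δ₀ : ℝ, 0 < δ₀ ∧ ∀ δ, δ₀ ≤ δ → ∀ t : ℝ, ∫ s in (-1)..1, e (δ * (t - s)) ≤ ε := by
  have hK0 : 0 ≤ K := (abs_nonneg _).trans (hK 0)
  obtain ⟨R₁, hR₁⟩ := eventually_atTop.1 (htop.eventually (ge_mem_nhds (show 0 < ε / 4 by linarith)))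
  obtain ⟨R₂, hR₂⟩ := eventually_atBot.1 (hbot.eventually (ge_mem_nhds (show 0 < ε / 4 by linarith)))
  set R := max 1 (max R₁ (-R₂)) with hR
  have hR1 : 1 ≤ R := le_max_left _ _
  have hR2 : R₁ ≤ R := (le_max_left _ _).trans (le_max_right _ _)
  have hR3 : -R₂ ≤ R := (le_max_right _ _).trans (le_max_right _ _)
  -- With this scale the window `J` contributes at most `2RK/δ ≤ ε/2`; outside it `e ≤ ε/4` on an
  -- interval of length `2`.
  refine ⟨4 * R * (K + 1) / ε, by positivity, fun δ hδ t => ?_⟩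
  have hδ0 : 0 < δ := lt_of_lt_of_le (by positivity) hδ
  set J : Set ℝ := Set.Icc (t - R / δ) (t + R / δ)
  have hpt : ∀ s, e (δ * (t - s)) ≤ ε / 4 + J.indicator (fun _ => K) s := fun s => by
    by_cases hs : s ∈ J
    · rw [Set.indicator_of_mem hs]
      linarith [(abs_le.1 (hK (δ * (t - s)))).2]
    · rw [Set.indicator_of_notMem hs, add_zero]
      by_cases h1 : t - R / δ ≤ s
      · have h2 : t + R / δ < s := by
          by_contra h; exact hs ⟨h1, not_lt.1 h⟩
        refine hR₂ _ ?_
        have : R / δ < s - t := by linarith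
        rw [div_lt_iff₀ hδ0] at this
        nlinarith
      · refine hR₁ _ ?_
        have : R / δ < t - s := by linarith
        rw [div_lt_iff₀ hδ0] at this
        nlinarith
  have hJ : Integrable (J.indicator fun _ => K) volume :=
    (integrable_indicator_iff measurableSet_Icc).2
      (integrableOn_const (by simp) (by simp))
  have he' : IntervalIntegrable (fun s => e (δ * (t - s))) volume (-1) 1 := by
    refine (intervalIntegrable_const (c := K)).mono_fun
      (he.comp (by fun_prop)).aestronglyMeasurable (ae_of_all _ fun s => ?_)
    simpa [abs_of_nonneg hK0] using hK (δ * (t - s))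
  calc ∫ s in (-1)..1, e (δ * (t - s))
      ≤ ∫ s in (-1)..1, (ε / 4 + J.indicator (fun _ => K) s) :=
        intervalIntegral.integral_mono (by norm_num) he'
          (intervalIntegrable_const.add hJ.intervalIntegrable) hpt
    _ = ε / 2 + ∫ s in (-1)..1, J.indicator (fun _ => K) s := by
        rw [intervalIntegral.integral_add intervalIntegrable_const hJ.intervalIntegrable]
        simp; ring
    _ ≤ ε / 2 + ∫ s, J.indicator (fun _ => K) s := by
        gcongr
        rw [intervalIntegral.integral_of_le (by norm_num)]
        exact setIntegral_le_integral hJ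
          (ae_of_all _ fun s => Set.indicator_nonneg (fun _ _ => hK0) s)
    _ = ε / 2 + 2 * R / δ * K := by
        rw [integral_indicator measurableSet_Icc, setIntegral_const]
        simp only [Real.volume_real_Icc_of_le (show t - R / δ ≤ t + R / δ by
          have : 0 ≤ R / δ := by positivity
          linarith), smul_eq_mul]
        ring
    _ ≤ ε := by
        rw [div_le_iff₀ hε] at hδ
        have : 2 * R / δ * K ≤ ε / 2 := by
          rw [div_mul_eq_mul_div, div_le_iff₀ hδ0]
          nlinarith
        linarith

/-! ### Fourier representation as a mixture of steps -/

theorem HasFiniteFourierMoment.continuous_fourierOf {d : ℕ} {g : (Fin d → ℝ) → ℝ}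
    (hg : HasFiniteFourierMoment g) : Continuous (fourierOf g) :=
  VectorFourier.fourierIntegral_continuous Real.continuous_fourierChar
    (innerSL ℝ).continuous₂ hg.integrable.ofReal

theorem HasFiniteFourierMoment.apply_eq {d : ℕ} {g : (Fin d → ℝ) → ℝ}
    (hg : HasFiniteFourierMoment g) (z : Fin d → ℝ) :
    (g z : ℂ) = 𝓕⁻ (fourierOf g) (WithLp.toLp 2 z) :=
  hg.representation (WithLp.toLp 2 z)

theorem HasFiniteFourierMoment.continuous {d : ℕ} {g : (Fin d → ℝ) → ℝ}
    (hg : HasFiniteFourierMoment g) : Continuous g := by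
  have h : Continuous (𝓕⁻ (fourierOf g)) :=
    VectorFourier.fourierIntegral_continuous Real.continuous_fourierChar
      (-innerSL ℝ : EuclideanSpace ℝ (Fin d) →L[ℝ] _).continuous₂ hg.integrable_fourier
  have h2 : g = fun z => (𝓕⁻ (fourierOf g) (WithLp.toLp 2 z)).re := by
    ext z; rw [← hg.apply_eq]; simp
  rw [h2]
  exact Complex.continuous_re.comp (h.comp (PiLp.continuous_toLp 2 _))

/-- The `ℓ¹` norm of the angular frequency `2πη`. -/
def freqNorm {d : ℕ} (η : EuclideanSpace ℝ (Fin d)) : ℝ := ∑ j, |2 * Real.pi * η j|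

theorem freqNorm_nonneg {d : ℕ} (η : EuclideanSpace ℝ (Fin d)) : 0 ≤ freqNorm η :=
  Finset.sum_nonneg fun _ _ => abs_nonneg _

theorem continuous_freqNorm {d : ℕ} : Continuous (freqNorm (d := d)) := by
  unfold freqNorm; fun_prop

/-- The angular phase `2πηᵀz`. -/
def phase {d : ℕ} (η : EuclideanSpace ℝ (Fin d)) (z : Fin d → ℝ) : ℝ :=
  (fun j => 2 * Real.pi * η j) ⬝ᵥ z

theorem continuous_phase {d : ℕ} (z : Fin d → ℝ) : Continuous fun η => phase η z := by
  unfold phase dotProduct; fun_prop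

theorem abs_phase_le {d : ℕ} (η : EuclideanSpace ℝ (Fin d)) {z : Fin d → ℝ}
    (hz : ∀ j, |z j| ≤ 1) : |phase η z| ≤ freqNorm η := by
  unfold phase dotProduct freqNorm
  refine (Finset.abs_sum_le_sum_abs _ _).trans (Finset.sum_le_sum fun j _ => ?_)
  rw [abs_mul]
  exact mul_le_of_le_one_right (abs_nonneg _) (hz j)

/-- The derivative of the unit wave `t ↦ Re (G / |G| exp (iwt))` divided by `w`. -/
def waveSlope (G : ℂ) (w s : ℝ) : ℝ :=
  (G / ‖G‖ * Complex.I * Complex.exp ((w * s : ℝ) * Complex.I)).re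

theorem abs_waveSlope_le (G : ℂ) (w s : ℝ) : |waveSlope G w s| ≤ 1 := by
  refine (Complex.abs_re_le_norm _).trans ?_
  rw [norm_mul, Complex.norm_exp_ofReal_mul_I, mul_one, norm_mul, Complex.norm_I, mul_one, norm_div]
  simpa using div_self_le_one ‖G‖

theorem continuous_waveSlope (G : ℂ) (w : ℝ) : Continuous (waveSlope G w) := by
  unfold waveSlope; fun_prop

/-- The right side vanishes at `t = 0` and has derivative `w * ‖G‖ * waveSlope G w t`. For `G = 0`
the phase factor `G / ‖G‖` is `0` and both sides vanish. -/
theorem integral_waveSlope (G : ℂ) (w t : ℝ) :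
    w * ‖G‖ * ∫ s in (0)..t, waveSlope G w s
      = (G * (Complex.exp ((w * t : ℝ) * Complex.I) - 1)).re := by
  rw [← intervalIntegral.integral_const_mul]
  have hd : ∀ s ∈ Set.uIcc 0 t, HasDerivAt
      (fun s : ℝ => (G * (Complex.exp ((w * s : ℝ) * Complex.I) - 1)).re)
      (w * ‖G‖ * waveSlope G w s) s := fun s _ => by
    have h1 : HasDerivAt (fun s : ℝ => ((w * s : ℝ) : ℂ) * Complex.I) (w * Complex.I) s := by
      have := ((hasDerivAt_id s).const_mul w).ofReal_comp.mul_const Complex.I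
      simpa using this
    have h2 : HasDerivAt (fun s : ℝ => G * (Complex.exp ((w * s : ℝ) * Complex.I) - 1))
        (G * (Complex.exp ((w * s : ℝ) * Complex.I) * (w * Complex.I))) s :=
      ((h1.cexp).sub_const 1).const_mul G
    have h3 := (Complex.reCLM.hasFDerivAt.comp_hasDerivAt s h2)
    have h4 : Complex.reCLM (G * (Complex.exp ((w * s : ℝ) * Complex.I) * (w * Complex.I)))
        = w * ‖G‖ * waveSlope G w s := by
      rw [Complex.reCLM_apply, waveSlope, ← Complex.re_ofReal_mul (w * ‖G‖)]
      congr 1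
      rcases eq_or_ne G 0 with rfl | hG
      · simp
      · have : (‖G‖ : ℂ) ≠ 0 := by simpa using hG
        push_cast
        field_simp
    rw [h4] at h3
    exact h3
  rw [intervalIntegral.integral_eq_sub_of_hasDerivAt hd
    (((continuous_waveSlope G w).const_mul _).intervalIntegrable _ _)]
  simp

/-- The Fourier representation of `g - g 0` on the cube as a mixture of step functions of
one-dimensional projections. -/
theorem HasFiniteFourierMoment.sub_eq_integral {d : ℕ} {g : (Fin d → ℝ) → ℝ}
    (hg : HasFiniteFourierMoment g) {z : Fin d → ℝ} (hz : ∀ j, |z j| ≤ 1) :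
    g z - g 0 = ∫ η : EuclideanSpace ℝ (Fin d), freqNorm η * ‖fourierOf g η‖ *
      (2⁻¹ * ∫ s in (-1)..1, waveSlope (fourierOf g η) (freqNorm η) s *
        (unitStep (phase η z / freqNorm η - s) + unitStep s)) := by
  have hint : ∀ z : Fin d → ℝ, Integrable fun η : EuclideanSpace ℝ (Fin d) =>
      Complex.exp ((phase η z : ℝ) * Complex.I) * fourierOf g η := fun z => by
    refine hg.integrable_fourier.bdd_mul (c := 1) ?_ (ae_of_all _ fun η => ?_)
    · have := continuous_phase z
      exact (by fun_prop : Continuous fun η : EuclideanSpace ℝ (Fin d) =>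
        Complex.exp ((phase η z : ℝ) * Complex.I)).aestronglyMeasurable
    · rw [Complex.norm_exp_ofReal_mul_I]
  have hrep : ∀ z : Fin d → ℝ, (g z : ℂ) = ∫ η : EuclideanSpace ℝ (Fin d),
      Complex.exp ((phase η z : ℝ) * Complex.I) * fourierOf g η := fun z => by
    rw [hg.apply_eq, Real.fourierInv_eq']
    refine integral_congr_ae (ae_of_all _ fun η => ?_)
    have : 2 * Real.pi * inner ℝ η (WithLp.toLp 2 z) = phase η z := by
      simp only [phase, dotProduct, PiLp.inner_apply, Finset.mul_sum]
      refine Finset.sum_congr rfl fun j _ => ?_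
      simp; ring
    simp only [this, smul_eq_mul]
  have h1 : ((g z - g 0 : ℝ) : ℂ) = ∫ η : EuclideanSpace ℝ (Fin d),
      fourierOf g η * (Complex.exp ((phase η z : ℝ) * Complex.I) - 1) := by
    rw [Complex.ofReal_sub, hrep z, hrep 0, ← integral_sub (hint z) (hint 0)]
    refine integral_congr_ae (ae_of_all _ fun η => ?_)
    simp [phase]; ring
  have hint2 : Integrable fun η : EuclideanSpace ℝ (Fin d) =>
      fourierOf g η * (Complex.exp ((phase η z : ℝ) * Complex.I) - 1) := by
    refine ((hint z).sub (hint 0)).congr (ae_of_all _ fun η => ?_)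
    simp [phase]; ring
  have h2 : g z - g 0 = ∫ η : EuclideanSpace ℝ (Fin d),
      (fourierOf g η * (Complex.exp ((phase η z : ℝ) * Complex.I) - 1)).re := by
    rw [← Complex.ofReal_re (g z - g 0), h1]
    exact (Complex.reCLM.integral_comp_comm hint2).symm
  rw [h2]
  refine integral_congr_ae (ae_of_all _ fun η => ?_)
  have hle := abs_phase_le η hz
  have ht : |phase η z / freqNorm η| ≤ 1 := by
    rw [abs_div, abs_of_nonneg (freqNorm_nonneg η)]
    exact div_le_one_of_le₀ hle (freqNorm_nonneg η)
  -- At zero frequency the quotient is `0` by convention, and the phase vanishes as well.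
  have hmul : freqNorm η * (phase η z / freqNorm η) = phase η z := by
    rcases eq_or_ne (freqNorm η) 0 with h0 | h0
    · rw [h0, abs_nonpos_iff] at hle
      · simp [h0, hle]
    · field_simp
  have := integral_waveSlope (fourierOf g η) (freqNorm η) (phase η z / freqNorm η)
  rw [hmul] at this
  simp only
  rw [integral_mul_unitStep (continuous_waveSlope _ _) ht, ← this]
  ring

/-! ### The sampling distribution of frequency and step location -/

/-- The uniform distribution on `[-1, 1]`. -/
def uniformCut : Measure ℝ := (2⁻¹ : ℝ≥0∞) • volume.restrict (Set.Ioc (-1) 1)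

instance : IsProbabilityMeasure uniformCut := ⟨by
  simp [uniformCut]; norm_num
  exact ENNReal.inv_mul_cancel (by norm_num) (by norm_num)⟩

theorem integral_uniformCut (h : ℝ → ℝ) : ∫ s, h s ∂uniformCut = 2⁻¹ * ∫ s in (-1)..1, h s := by
  rw [uniformCut, integral_smul_measure, intervalIntegral.integral_of_le (by norm_num)]
  simp

/-- The Fourier magnitude distribution of `g`, weighted by frequency and normalized. -/
def freqMeasure {d : ℕ} (g : (Fin d → ℝ) → ℝ) : Measure (EuclideanSpace ℝ (Fin d)) :=
  volume.withDensity fun η => ENNReal.ofReal (freqNorm η * ‖fourierOf g η‖ / fourierMoment g)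

theorem fourierMoment_nonneg {d : ℕ} (g : (Fin d → ℝ) → ℝ) : 0 ≤ fourierMoment g :=
  integral_nonneg fun η => mul_nonneg (freqNorm_nonneg η) (norm_nonneg _)

theorem HasFiniteFourierMoment.integrable_freqNorm_mul {d : ℕ} {g : (Fin d → ℝ) → ℝ}
    (hg : HasFiniteFourierMoment g) : Integrable fun η => freqNorm η * ‖fourierOf g η‖ :=
  hg.integrable_moment

theorem HasFiniteFourierMoment.isProbabilityMeasure_freqMeasure {d : ℕ} {g : (Fin d → ℝ) → ℝ}
    (hg : HasFiniteFourierMoment g) (h0 : 0 < fourierMoment g) :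
    IsProbabilityMeasure (freqMeasure g) := ⟨by
  rw [freqMeasure, withDensity_apply _ MeasurableSet.univ, Measure.restrict_univ,
    ← ofReal_integral_eq_lintegral_ofReal (hg.integrable_freqNorm_mul.div_const _)
      (ae_of_all _ fun η => div_nonneg (mul_nonneg (freqNorm_nonneg η) (norm_nonneg _)) h0.le),
    integral_div]
  change ENNReal.ofReal (fourierMoment g / fourierMoment g) = 1
  rw [div_self h0.ne', ENNReal.ofReal_one]⟩

/-- The joint distribution of the frequency and the location of the step. -/
def waveMeasure {d : ℕ} (g : (Fin d → ℝ) → ℝ) : Measure (EuclideanSpace ℝ (Fin d) × ℝ) :=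
  (freqMeasure g).prod uniformCut

/-- The factor `fourierMoment g` cancels the normalization of the density, leaving the weight of the
Fourier representation. -/
theorem HasFiniteFourierMoment.integral_waveMeasure {d : ℕ} {g : (Fin d → ℝ) → ℝ}
    (hg : HasFiniteFourierMoment g) (h0 : 0 < fourierMoment g)
    {h : EuclideanSpace ℝ (Fin d) × ℝ → ℝ} (hh : Integrable h (waveMeasure g)) :
    fourierMoment g * ∫ q, h q ∂(waveMeasure g) = ∫ η : EuclideanSpace ℝ (Fin d),
      freqNorm η * ‖fourierOf g η‖ * (2⁻¹ * ∫ s in (-1)..1, h (η, s)) := by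
  have := hg.isProbabilityMeasure_freqMeasure h0
  have hm : Measurable fun η : EuclideanSpace ℝ (Fin d) =>
      ENNReal.ofReal (freqNorm η * ‖fourierOf g η‖ / fourierMoment g) := by
    have := hg.continuous_fourierOf.measurable
    have := (continuous_freqNorm (d := d)).measurable
    fun_prop
  rw [waveMeasure, integral_prod _ hh, freqMeasure,
    integral_withDensity_eq_integral_toReal_smul hm (ae_of_all _ fun _ => ENNReal.ofReal_lt_top),
    ← integral_const_mul]
  refine integral_congr_ae (ae_of_all _ fun η => ?_)
  simp only [integral_uniformCut, smul_eq_mul]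
  rw [ENNReal.toReal_ofReal
    (div_nonneg (mul_nonneg (freqNorm_nonneg η) (norm_nonneg _)) h0.le)]
  field_simp

/-- Zero frequencies have density `0`, so a bound at positive frequencies suffices. The `2` offsets
the density `1/2` of the uniform cut. -/
theorem HasFiniteFourierMoment.integral_waveMeasure_le {d : ℕ} {g : (Fin d → ℝ) → ℝ}
    (hg : HasFiniteFourierMoment g) (h0 : 0 < fourierMoment g)
    {h : EuclideanSpace ℝ (Fin d) × ℝ → ℝ} (hh : Integrable h (waveMeasure g))
    (hpos : ∀ q, 0 ≤ h q) {ε : ℝ}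
    (hε : ∀ η, 0 < freqNorm η → ∫ s in (-1)..1, h (η, s) ≤ 2 * ε) :
    ∫ q, h q ∂(waveMeasure g) ≤ ε := by
  have h1 : fourierMoment g * ∫ q, h q ∂(waveMeasure g) ≤ fourierMoment g * ε := by
    rw [hg.integral_waveMeasure h0 hh, fourierMoment, ← integral_mul_const]
    refine integral_mono_of_nonneg (ae_of_all _ fun η => ?_)
      (hg.integrable_moment.mul_const ε) (ae_of_all _ fun η => ?_)
    · exact mul_nonneg (mul_nonneg (freqNorm_nonneg η) (norm_nonneg _))
        (mul_nonneg (by norm_num)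
          (intervalIntegral.integral_nonneg (by norm_num) fun s _ => hpos _))
    · change freqNorm η * ‖fourierOf g η‖ * _ ≤ freqNorm η * ‖fourierOf g η‖ * ε
      rcases (freqNorm_nonneg η).eq_or_lt with h | h
      · simp [← h]
      · have := hε η h
        have h3 : 0 ≤ freqNorm η * ‖fourierOf g η‖ := mul_nonneg h.le (norm_nonneg _)
        gcongr
        linarith
  exact le_of_mul_le_mul_left h1 h0

/-- The difference `φ - unitStep` is bounded and vanishes at both infinities, and the step is
unchanged by the positive scaling `δ`. -/
theorem IsSigmoidalActivation.exists_scale {φ : ℝ → ℝ} (hφ : IsSigmoidalActivation φ) {ε : ℝ}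
    (hε : 0 < ε) : ∃ δ₀ : ℝ, 0 < δ₀ ∧ ∀ δ, δ₀ ≤ δ → ∀ t : ℝ,
      ∫ s in (-1)..1, |φ (δ * (t - s)) - unitStep (t - s)| ≤ 2 * ε := by
  obtain ⟨a₀, -, ha⟩ := hφ.bounded
  have htop : Tendsto (fun r => |φ r - unitStep r|) atTop (𝓝 0) := by
    have h : Tendsto (fun r => |φ r - 1|) atTop (𝓝 0) := by
      simpa using (hφ.tendsto_atTop.sub_const 1).abs
    refine h.congr' ?_
    filter_upwards [eventually_gt_atTop 0] with r hr
    simp [unitStep, hr]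
  have hbot : Tendsto (fun r => |φ r - unitStep r|) atBot (𝓝 0) := by
    have h : Tendsto (fun r => |φ r - -1|) atBot (𝓝 0) := by
      simpa using (hφ.tendsto_atBot.sub_const (-1)).abs
    refine h.congr' ?_
    filter_upwards [eventually_lt_atBot 0] with r hr
    simp [unitStep, hr.not_gt]
  obtain ⟨δ₀, h0, h⟩ := exists_scale_integral_le (e := fun r => |φ r - unitStep r|) (K := a₀ + 1)
    ((hφ.differentiable.continuous.measurable.sub measurable_unitStep).abs) (fun r => by
      rw [abs_abs]
      have h1 := abs_sub (φ r) (unitStep r)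
      rw [abs_unitStep] at h1
      linarith [ha r]) htop hbot (show 0 < 2 * ε by linarith)
  refine ⟨δ₀, h0, fun δ hδ t => ?_⟩
  have := h δ hδ t
  simpa only [unitStep_mul (h0.trans_le hδ)] using this

/-! ### Nodes and their parameter bounds -/

/-- Inner weights `δ 2πη / ‖2πη‖₁` of a node. -/
def nodeWeight {d : ℕ} (δ : ℝ) (η : EuclideanSpace ℝ (Fin d)) : Fin d → ℝ :=
  fun j => δ * (2 * Real.pi * η j / freqNorm η)

/-- Bias of a node whose step is located at `s`, truncated to `[-1, 1]`. -/
def nodeBias {d : ℕ} (δ : ℝ) (q : EuclideanSpace ℝ (Fin d) × ℝ) : ℝ :=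
  -((∑ j, |nodeWeight δ q.1 j|) * max (-1) (min 1 q.2))

theorem sum_abs_nodeWeight {d : ℕ} {δ : ℝ} (hδ : 0 ≤ δ) {η : EuclideanSpace ℝ (Fin d)}
    (hη : 0 < freqNorm η) : ∑ j, |nodeWeight δ η j| = δ := by
  simp only [nodeWeight, abs_mul δ, abs_div, abs_of_nonneg hδ, abs_of_pos hη]
  rw [← Finset.mul_sum, ← Finset.sum_div]
  change δ * (freqNorm η / freqNorm η) = δ
  rw [div_self hη.ne', mul_one]

theorem sum_abs_nodeWeight_le {d : ℕ} {δ : ℝ} (hδ : 0 ≤ δ) (η : EuclideanSpace ℝ (Fin d)) :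
    ∑ j, |nodeWeight δ η j| ≤ δ := by
  rcases (freqNorm_nonneg η).eq_or_lt with h | h
  · simpa [nodeWeight, ← h] using hδ
  · exact (sum_abs_nodeWeight hδ h).le

/-- The truncation and the factor `∑ j, |nodeWeight δ q.1 j|`, in place of `δ`, make the constraint
hold for every outcome, even at zero frequency or for `s` outside `[-1, 1]`, and not just almost
surely. -/
theorem abs_nodeBias_le {d : ℕ} (δ : ℝ) (q : EuclideanSpace ℝ (Fin d) × ℝ) :
    |nodeBias δ q| ≤ ∑ j, |nodeWeight δ q.1 j| := by
  have h : 0 ≤ ∑ j, |nodeWeight δ q.1 j| := Finset.sum_nonneg fun _ _ => abs_nonneg _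
  rw [nodeBias, abs_neg, abs_mul, abs_of_nonneg h]
  refine mul_le_of_le_one_right h (abs_le.2 ⟨le_max_left _ _, ?_⟩)
  exact max_le (by norm_num) (min_le_left _ _)

theorem nodeWeight_dotProduct_add {d : ℕ} {δ : ℝ} (hδ : 0 ≤ δ) {η : EuclideanSpace ℝ (Fin d)}
    (hη : 0 < freqNorm η) (z : Fin d → ℝ) {s : ℝ} (hs : s ∈ Set.Icc (-1 : ℝ) 1) :
    nodeWeight δ η ⬝ᵥ z + nodeBias δ (η, s) = δ * (phase η z / freqNorm η - s) := by
  rw [nodeBias, sum_abs_nodeWeight hδ hη, min_eq_right hs.2, max_eq_right hs.1]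
  have : nodeWeight δ η ⬝ᵥ z = δ * (phase η z / freqNorm η) := by
    simp only [dotProduct, nodeWeight, phase, Finset.sum_div, Finset.mul_sum]
    refine Finset.sum_congr rfl fun j _ => ?_
    ring
  rw [this]; ring

theorem measurable_node {d : ℕ} (δ : ℝ) :
    Measurable fun r : (EuclideanSpace ℝ (Fin d) × ℝ) × (Fin d → ℝ) =>
      nodeWeight δ r.1.1 ⬝ᵥ r.2 + nodeBias δ r.1 := by
  have h := (continuous_freqNorm (d := d)).measurable
  unfold nodeBias dotProduct nodeWeight
  fun_prop

theorem measurable_node_left {d : ℕ} (δ : ℝ) (z : Fin d → ℝ) :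
    Measurable fun q : EuclideanSpace ℝ (Fin d) × ℝ =>
      nodeWeight δ q.1 ⬝ᵥ z + nodeBias δ q :=
  (measurable_node δ).comp
    (g := fun r : (EuclideanSpace ℝ (Fin d) × ℝ) × (Fin d → ℝ) =>
      nodeWeight δ r.1.1 ⬝ᵥ r.2 + nodeBias δ r.1)
    (f := fun q => (q, z)) (measurable_id.prodMk measurable_const)

/-- The sign pattern of the Fourier waves of `g` at frequency `q.1` and location `q.2`. -/
def slopeOf {d : ℕ} (g : (Fin d → ℝ) → ℝ) (q : EuclideanSpace ℝ (Fin d) × ℝ) : ℝ :=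
  waveSlope (fourierOf g q.1) (freqNorm q.1) q.2

theorem abs_slopeOf_le {d : ℕ} (g : (Fin d → ℝ) → ℝ) (q : EuclideanSpace ℝ (Fin d) × ℝ) :
    |slopeOf g q| ≤ 1 := abs_waveSlope_le _ _ _

theorem abs_slopeOf_mul_le {d : ℕ} (g : (Fin d → ℝ) → ℝ) (q : EuclideanSpace ℝ (Fin d) × ℝ)
    (y : ℝ) : |slopeOf g q * y| ≤ |y| := by
  rw [abs_mul]
  exact mul_le_of_le_one_left (abs_nonneg _) (abs_slopeOf_le g q)

/-- The step at `s = q.2` of the projection of `z` to the direction `q.1`. -/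
def waveStep {d : ℕ} (z : Fin d → ℝ) (q : EuclideanSpace ℝ (Fin d) × ℝ) : ℝ :=
  unitStep (phase q.1 z / freqNorm q.1 - q.2)

theorem measurable_waveStep {d : ℕ} (z : Fin d → ℝ) : Measurable (waveStep z) := by
  have h := (continuous_freqNorm (d := d)).measurable
  have h' := (continuous_phase z).measurable
  exact measurable_unitStep.comp (by fun_prop)

/-! ### Bias and second moment of a random node -/

namespace HasFiniteFourierMoment

variable {d : ℕ} {g : (Fin d → ℝ) → ℝ}

theorem measurable_slopeOf (hg : HasFiniteFourierMoment g) : Measurable (slopeOf g) := by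
  have h := (continuous_freqNorm (d := d)).measurable
  have h' := hg.continuous_fourierOf.measurable
  unfold slopeOf waveSlope
  fun_prop

theorem isProbabilityMeasure_waveMeasure (hg : HasFiniteFourierMoment g)
    (h0 : 0 < fourierMoment g) : IsProbabilityMeasure (waveMeasure g) := by
  have := hg.isProbabilityMeasure_freqMeasure h0
  unfold waveMeasure
  infer_instance

theorem integrable_slopeOf_mul (hg : HasFiniteFourierMoment g) (h0 : 0 < fourierMoment g)
    {y : EuclideanSpace ℝ (Fin d) × ℝ → ℝ} (hy : Measurable y) {K : ℝ} (hK : ∀ q, |y q| ≤ K) :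
    Integrable (fun q => slopeOf g q * y q) (waveMeasure g) := by
  have := hg.isProbabilityMeasure_waveMeasure h0
  exact Integrable.of_bound (hg.measurable_slopeOf.mul hy).aestronglyMeasurable K
    (ae_of_all _ fun q => (abs_slopeOf_mul_le g q _).trans (hK q))

theorem abs_integral_slopeOf_mul_le (hg : HasFiniteFourierMoment g) (h0 : 0 < fourierMoment g)
    {y : EuclideanSpace ℝ (Fin d) × ℝ → ℝ} (hy : ∀ q, |y q| ≤ 1) :
    |∫ q, slopeOf g q * y q ∂(waveMeasure g)| ≤ 1 := by
  have := hg.isProbabilityMeasure_waveMeasure h0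
  simpa using norm_integral_le_of_norm_le_const (μ := waveMeasure g) (C := 1)
    (f := fun q => slopeOf g q * y q) (ae_of_all _ fun q => (abs_slopeOf_mul_le g q _).trans (hy q))

/-- On the cube, `g - g 0` is `C_g` times an average of signed steps. -/
theorem sub_eq_integral_waveMeasure (hg : HasFiniteFourierMoment g) (h0 : 0 < fourierMoment g)
    {z : Fin d → ℝ} (hz : ∀ j, |z j| ≤ 1) :
    g z - g 0 = fourierMoment g * (∫ q, slopeOf g q * waveStep z q ∂(waveMeasure g)
      + ∫ q, slopeOf g q * unitStep q.2 ∂(waveMeasure g)) := by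
  have h1 := hg.integrable_slopeOf_mul h0 (measurable_waveStep z)
    (fun q => (abs_unitStep _).le)
  have h2 := hg.integrable_slopeOf_mul h0 (measurable_unitStep.comp measurable_snd)
    (fun q => (abs_unitStep _).le)
  simp only [Function.comp_apply] at h2
  rw [hg.sub_eq_integral hz, ← integral_add h1 h2, hg.integral_waveMeasure h0 (h1.fun_add h2)]
  refine integral_congr_ae (ae_of_all _ fun η => ?_)
  simp only [slopeOf, waveStep, mul_add]

theorem eq_of_fourierMoment_eq_zero (hg : HasFiniteFourierMoment g) (h0 : fourierMoment g = 0)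
    {z : Fin d → ℝ} (hz : ∀ j, |z j| ≤ 1) : g z = g 0 := by
  rw [← sub_eq_zero, hg.sub_eq_integral hz]
  have h1 : (fun η => freqNorm η * ‖fourierOf g η‖) =ᵐ[volume] 0 :=
    (integral_eq_zero_iff_of_nonneg (fun η => mul_nonneg (freqNorm_nonneg η) (norm_nonneg _))
      hg.integrable_freqNorm_mul).1 h0
  refine integral_eq_zero_of_ae ?_
  filter_upwards [h1] with η hη
  simp only [Pi.zero_apply] at hη ⊢
  rw [hη, zero_mul]

variable {φ : ℝ → ℝ} {δ ε a₀ : ℝ}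

theorem integral_abs_node_sub_le (hg : HasFiniteFourierMoment g) (h0 : 0 < fourierMoment g)
    (hφ : Continuous φ) (ha : ∀ r, |φ r| ≤ a₀) (hδ : 0 ≤ δ)
    (hscale : ∀ t : ℝ, ∫ s in (-1)..1, |φ (δ * (t - s)) - unitStep (t - s)| ≤ 2 * ε)
    (z : Fin d → ℝ) :
    Integrable (fun q => |φ (nodeWeight δ q.1 ⬝ᵥ z + nodeBias δ q) - waveStep z q|)
      (waveMeasure g) ∧
    ∫ q, |φ (nodeWeight δ q.1 ⬝ᵥ z + nodeBias δ q) - waveStep z q| ∂(waveMeasure g) ≤ ε := by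
  have := hg.isProbabilityMeasure_waveMeasure h0
  have hm : Measurable fun q : EuclideanSpace ℝ (Fin d) × ℝ =>
      φ (nodeWeight δ q.1 ⬝ᵥ z + nodeBias δ q) :=
    hφ.measurable.comp (measurable_node_left δ z)
  have hi : Integrable (fun q => |φ (nodeWeight δ q.1 ⬝ᵥ z + nodeBias δ q) - waveStep z q|)
      (waveMeasure g) :=
    Integrable.of_bound (hm.sub (measurable_waveStep z)).abs.aestronglyMeasurable (a₀ + 1)
      (ae_of_all _ fun q => by
        rw [Real.norm_eq_abs, abs_abs]
        have h1 := abs_sub (φ (nodeWeight δ q.1 ⬝ᵥ z + nodeBias δ q)) (waveStep z q)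
        have h2 : |waveStep z q| = 1 := abs_unitStep _
        linarith [ha (nodeWeight δ q.1 ⬝ᵥ z + nodeBias δ q)])
  refine ⟨hi, hg.integral_waveMeasure_le h0 hi (fun _ => abs_nonneg _) fun η hη => ?_⟩
  -- For fixed `η` the projection is a fixed `t`; uniformity of `hscale` in `t` makes the bound
  -- independent of `η` and `z`.
  refine le_trans (le_of_eq ?_) (hscale (phase η z / freqNorm η))
  refine intervalIntegral.integral_congr fun s hs => ?_
  rw [Set.uIcc_of_le (by norm_num)] at hs
  simp only [nodeWeight_dotProduct_add hδ hη z hs, waveStep]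

theorem abs_integral_node_sub_le (hg : HasFiniteFourierMoment g) (h0 : 0 < fourierMoment g)
    (hφ : Continuous φ) (ha : ∀ r, |φ r| ≤ a₀) (hδ : 0 ≤ δ)
    (hscale : ∀ t : ℝ, ∫ s in (-1)..1, |φ (δ * (t - s)) - unitStep (t - s)| ≤ 2 * ε)
    (z : Fin d → ℝ) :
    |∫ q, slopeOf g q * waveStep z q ∂(waveMeasure g)
      - ∫ q, slopeOf g q * φ (nodeWeight δ q.1 ⬝ᵥ z + nodeBias δ q) ∂(waveMeasure g)| ≤ ε := by
  obtain ⟨hi, hle⟩ := hg.integral_abs_node_sub_le h0 hφ ha hδ hscale z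
  have h1 := hg.integrable_slopeOf_mul h0 (measurable_waveStep z)
    (fun q => (abs_unitStep _).le)
  have h2 := hg.integrable_slopeOf_mul h0
    (hφ.measurable.comp (measurable_node_left δ z))
    (fun q => ha _)
  rw [abs_sub_comm]
  have h3 := integral_sub h2 h1
  simp only [Function.comp_apply] at h3
  rw [← h3]
  refine (abs_integral_le_integral_abs).trans (le_trans (integral_mono (h2.sub h1).abs hi ?_) hle)
  intro q
  dsimp only
  rw [← mul_sub]
  exact abs_slopeOf_mul_le g q _

/-- A step has square `1`, so `y² = 1 + (y + σ)(y - σ)` with `σ` the step. The bound is close to `1`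
rather than `a₀²`, which keeps the sup norm of `φ` out of the final constant. -/
theorem integral_sq_node_le (hg : HasFiniteFourierMoment g) (h0 : 0 < fourierMoment g)
    (hφ : Continuous φ) (ha : ∀ r, |φ r| ≤ a₀) (hδ : 0 ≤ δ)
    (hscale : ∀ t : ℝ, ∫ s in (-1)..1, |φ (δ * (t - s)) - unitStep (t - s)| ≤ 2 * ε)
    (z : Fin d → ℝ) :
    ∫ q, (slopeOf g q * φ (nodeWeight δ q.1 ⬝ᵥ z + nodeBias δ q)) ^ 2 ∂(waveMeasure g)
      ≤ 1 + (a₀ + 1) * ε := by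
  have := hg.isProbabilityMeasure_waveMeasure h0
  obtain ⟨hi, hle⟩ := hg.integral_abs_node_sub_le h0 hφ ha hδ hscale z
  have ha0 : 0 ≤ a₀ := (abs_nonneg _).trans (ha 0)
  have hpt : ∀ q, (slopeOf g q * φ (nodeWeight δ q.1 ⬝ᵥ z + nodeBias δ q)) ^ 2
      ≤ 1 + (a₀ + 1) * |φ (nodeWeight δ q.1 ⬝ᵥ z + nodeBias δ q) - waveStep z q| := fun q => by
    have h1 : |waveStep z q| = 1 := abs_unitStep _
    set y := φ (nodeWeight δ q.1 ⬝ᵥ z + nodeBias δ q) with hy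
    set σ := waveStep z q
    have h2 : (slopeOf g q * y) ^ 2 ≤ y ^ 2 := sq_le_sq.2 (abs_slopeOf_mul_le g q y)
    have h3 : σ ^ 2 = 1 := by rw [← sq_abs, h1, one_pow]
    have h4 : |y + σ| ≤ a₀ + 1 :=
      (abs_add_le _ _).trans (by
        rw [h1]
        linarith [ha (nodeWeight δ q.1 ⬝ᵥ z + nodeBias δ q)])
    have h5 : (y + σ) * (y - σ) ≤ (a₀ + 1) * |y - σ| := by
      refine (le_abs_self _).trans ?_
      rw [abs_mul]
      gcongr
    nlinarith
  calc ∫ q, (slopeOf g q * φ (nodeWeight δ q.1 ⬝ᵥ z + nodeBias δ q)) ^ 2 ∂(waveMeasure g)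
      ≤ ∫ q, (1 + (a₀ + 1) * |φ (nodeWeight δ q.1 ⬝ᵥ z + nodeBias δ q) - waveStep z q|)
          ∂(waveMeasure g) :=
        integral_mono_of_nonneg (ae_of_all _ fun q => sq_nonneg _)
          ((integrable_const _).add (hi.const_mul _)) (ae_of_all _ hpt)
    _ ≤ 1 + (a₀ + 1) * ε := by
        rw [integral_add (integrable_const _) (hi.const_mul _), integral_const_mul]
        simp only [integral_const, probReal_univ, smul_eq_mul, mul_one]
        gcongr

end HasFiniteFourierMoment

theorem HasFiniteFourierMoment.measurable_slopeOf_mul_node {d : ℕ} {g : (Fin d → ℝ) → ℝ}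
    (hg : HasFiniteFourierMoment g) {φ : ℝ → ℝ} (hφ : Measurable φ) (δ : ℝ) {X : Type*}
    [MeasurableSpace X] {Z : X → Fin d → ℝ} (hZ : Measurable Z) :
    Measurable fun r : (EuclideanSpace ℝ (Fin d) × ℝ) × X =>
      slopeOf g r.1 * φ (nodeWeight δ r.1.1 ⬝ᵥ Z r.2 + nodeBias δ r.1) := by
  have h1 : Measurable fun r : (EuclideanSpace ℝ (Fin d) × ℝ) × X =>
      nodeWeight δ r.1.1 ⬝ᵥ Z r.2 + nodeBias δ r.1 :=
    Measurable.comp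
      (g := fun r : (EuclideanSpace ℝ (Fin d) × ℝ) × (Fin d → ℝ) =>
        nodeWeight δ r.1.1 ⬝ᵥ r.2 + nodeBias δ r.1)
      (f := fun r : (EuclideanSpace ℝ (Fin d) × ℝ) × X => (r.1, Z r.2))
      (measurable_node δ) (measurable_fst.prodMk (hZ.comp measurable_snd))
  exact (hg.measurable_slopeOf.comp measurable_fst).mul (hφ.comp h1)

end

/-! ### Choice of constants and assembly of the network -/

theorem proposition1 (φ : ℝ → ℝ) (hφ : IsSigmoidalActivation φ) (m : ℕ) (hm : 1 ≤ m) :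
    ∃ δ₀ : ℝ, 0 < δ₀ ∧
      ∀ (p d : ℕ) (β : Matrix (Fin p) (Fin d) ℝ) (g : (Fin d → ℝ) → ℝ) (f : (Fin p → ℝ) → ℝ)
        (μ : Measure (Fin p → ℝ)) (C δ : ℝ),
        IsProbabilityMeasure μ →
        (∀ᵐ x ∂μ, ∀ j, |(βᵀ *ᵥ x) j| ≤ 1) →
        (∀ x, f x = g (βᵀ *ᵥ x)) →
        HasFiniteFourierMoment g →
        fourierMoment g ≤ C → 0 < C →
        δ₀ ≤ δ → (∀ j, ∑ l, |β l j| ≤ δ) →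
        ∃ θ : NetParams d m, (θ, β) ∈ paramSet p d m δ C (g 0) ∧
          eLpNorm (fun x => f x - twoLayerNet φ θ β x) 2 μ ≤
            ENNReal.ofReal (2 * fourierMoment g / Real.sqrt m) := by
  obtain ⟨a₀, ha1, ha⟩ := hφ.bounded
  have hm0 : (0 : ℝ) < m := by exact_mod_cast hm
  have hsm : 1 ≤ Real.sqrt m := by
    rw [Real.one_le_sqrt]; exact_mod_cast hm
  have hsm0 : 0 < Real.sqrt m := by linarith
  -- The first bound limits the bias from replacing steps by sigmoids; the second keeps the second
  -- moment of a node at most `1 + 2 = 3`.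
  set ε : ℝ := min (1 / (2 * Real.sqrt m)) (2 / (a₀ + 1)) with hε
  have hε0 : 0 < ε := lt_min (by positivity) (by positivity)
  have hε1 : ε ≤ 1 / (2 * Real.sqrt m) := min_le_left _ _
  have hε2 : (a₀ + 1) * ε ≤ 2 := by
    have : ε ≤ 2 / (a₀ + 1) := min_le_right _ _
    rwa [le_div_iff₀ (by linarith), mul_comm] at this
  obtain ⟨δ₀, hδ₀, hscale⟩ := hφ.exists_scale hε0
  refine ⟨δ₀, hδ₀, fun p d β g f μ C δ hμ hcube hf hg hgC hC hδ hβ => ?_⟩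
  have hδ0 : 0 ≤ δ := (hδ₀.trans_le hδ).le
  rcases (fourierMoment_nonneg g).eq_or_lt with h0 | h0
  -- With zero moment the sampling density cannot be normalized, but `g` is then constant on the
  -- cube.
  · refine ⟨⟨0, 0, 0, g 0⟩, ⟨by simpa, by simpa, by simp, by simpa using fun _ => hδ0, hβ⟩, ?_⟩
    refine le_trans (le_of_eq ?_) zero_le
    rw [eLpNorm_congr_ae (g := 0), eLpNorm_zero]
    filter_upwards [hcube] with x hx
    simp [twoLayerNet, hf, hg.eq_of_fourierMoment_eq_zero h0.symm hx]
  have := hg.isProbabilityMeasure_waveMeasure h0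
  have hscale' := hscale δ hδ
  have hcont := hφ.differentiable.continuous
  set M := fourierMoment g with hM
  -- The bounds on `τ` are strict while `C = C_g` is allowed, so the amplitude is shrunk to `c = (1
  -- - κ) M < M`. As `|S + A| ≤ 2` below, this costs bias at most `2κM = M / (2√m)`.
  set κ : ℝ := 1 / (4 * Real.sqrt m) with hκ
  have hκ0 : 0 < κ := by positivity
  have hκ1 : κ < 1 := by
    rw [hκ, div_lt_one (by positivity)]; linarith
  set c : ℝ := (1 - κ) * M with hc
  have hc0 : 0 ≤ c := mul_nonneg (by linarith) h0.le
  have hcM : c < M := by nlinarith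
  set A : ℝ := ∫ q, slopeOf g q * unitStep q.2 ∂(waveMeasure g) with hA
  have hA1 : |A| ≤ 1 := hg.abs_integral_slopeOf_mul_le h0 fun q => (abs_unitStep _).le
  have hgm := hg.continuous.measurable
  have hlin : Measurable fun x : Fin p → ℝ => βᵀ *ᵥ x := by
    unfold Matrix.mulVec dotProduct; fun_prop
  obtain ⟨ω, hω⟩ := exists_average_eLpNorm_le (waveMeasure g) μ hm
    (Y := fun q x => c * (slopeOf g q * φ (nodeWeight δ q.1 ⬝ᵥ (βᵀ *ᵥ x) + nodeBias δ q)))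
    (F := fun x => f x - (g 0 + c * A)) (K := c * a₀) (b := M / Real.sqrt m) (V := 3 * M ^ 2)
    (r := 2 * M / Real.sqrt m)
    ((hg.measurable_slopeOf_mul_node hcont.measurable δ hlin).const_mul c)
    (fun q x => by
      rw [abs_mul, abs_of_nonneg hc0]
      exact mul_le_mul_of_nonneg_left ((abs_slopeOf_mul_le g q _).trans (ha _)) hc0)
    (by
      have : f = fun x => g (βᵀ *ᵥ x) := funext hf
      rw [this]
      exact (hgm.comp hlin).sub_const _)
    (by
      filter_upwards [hcube] with x hx
      have h1 := hg.sub_eq_integral_waveMeasure h0 hx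
      have h2 := hg.abs_integral_node_sub_le h0 hcont ha hδ0 hscale' (βᵀ *ᵥ x)
      have h3 := hg.abs_integral_slopeOf_mul_le h0 (y := waveStep (βᵀ *ᵥ x))
        fun q => (abs_unitStep _).le
      rw [integral_const_mul, hf]
      set S := ∫ q, slopeOf g q * waveStep (βᵀ *ᵥ x) q ∂(waveMeasure g)
      set N := ∫ q, slopeOf g q * φ (nodeWeight δ q.1 ⬝ᵥ (βᵀ *ᵥ x) + nodeBias δ q)
        ∂(waveMeasure g)
      -- The bias splits into the cost of shrinking and the cost of smoothing, each at most `M /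
      -- (2√m)`.
      have h4 : g (βᵀ *ᵥ x) - (g 0 + c * A) - c * N = M * (κ * (S + A)) + c * (S - N) := by
        rw [hc]; linear_combination h1
      have h5 : |S + A| ≤ 2 := (abs_add_le _ _).trans (by linarith)
      rw [h4]
      calc |M * (κ * (S + A)) + c * (S - N)|
          ≤ M * (κ * |S + A|) + c * |S - N| := by
            refine (abs_add_le _ _).trans (le_of_eq ?_)
            rw [abs_mul, abs_mul κ, abs_mul c, abs_of_pos h0, abs_of_pos hκ0, abs_of_nonneg hc0]
        _ ≤ M * (κ * 2) + M * (1 / (2 * Real.sqrt m)) := by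
            gcongr
            exact h2.trans hε1
        _ = M / Real.sqrt m := by rw [hκ]; field_simp; norm_num)
    (ae_of_all _ fun x => by
      have h1 := hg.integral_sq_node_le h0 hcont ha hδ0 hscale' (βᵀ *ᵥ x)
      simp only [mul_pow c]
      rw [integral_const_mul]
      calc c ^ 2 * _ ≤ M ^ 2 * 3 := by
            gcongr
            linarith
        _ = 3 * M ^ 2 := by ring)
    (by positivity)
    -- Squared bias `M²/m` plus variance bound `3M²/m` is `4M²/m = r²`.
    (by
      rw [div_pow, div_pow, Real.sq_sqrt hm0.le, ← add_div]
      gcongr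
      linarith)
  refine ⟨⟨fun i => nodeWeight δ (ω i).1, fun i => nodeBias δ (ω i),
    fun i => c * slopeOf g (ω i) / m, g 0 + c * A⟩, ⟨?_, ?_, fun i => abs_nodeBias_le _ _,
    fun i => sum_abs_nodeWeight_le hδ0 _, hβ⟩, ?_⟩
  · calc ∑ i, |c * slopeOf g (ω i) / m| ≤ ∑ _i : Fin m, c / m := by
          refine Finset.sum_le_sum fun i _ => ?_
          rw [abs_div, abs_mul, abs_of_nonneg hc0, abs_of_pos hm0]
          gcongr
          exact mul_le_of_le_one_right hc0 (abs_slopeOf_le _ _)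
      _ = c := by simp; field_simp
      _ < C := hcM.trans_le hgC
  · simp only [add_sub_cancel_left]
    rw [abs_mul, abs_of_nonneg hc0]
    exact (mul_le_of_le_one_right hc0 hA1).trans_lt (hcM.trans_le hgC)
  · refine le_trans (le_of_eq ?_) hω
    congr 1
    ext x
    have hx : firstLayer β x = βᵀ *ᵥ x := rfl
    simp only [twoLayerNet, hx, Finset.sum_div]
    have : ∀ i, c * slopeOf g (ω i) / m * φ (nodeWeight δ (ω i).1 ⬝ᵥ (βᵀ *ᵥ x) + nodeBias δ (ω i))
      = c * (slopeOf g (ω i) * φ (nodeWeight δ (ω i).1 ⬝ᵥ (βᵀ *ᵥ x) + nodeBias δ (ω i))) / m :=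
      fun i => by ring
    simp only [this]
    ring
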